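/- **Theorem 5.3 (Parabolic Schur–Weyl duality).** Let $V$ be a complex vector space of finite dimension $n$, let $r\ge 1$, and let $\underline V=V\oplus\mathbb C\eta\cong\mathbb C^{n+1}$. *Groups.* Let $\underline G=\mathrm{GL}(V)\times V$ with the product $(g_1,v_1)(g_2,v_2)=(g_1g_2,\,g_1v_2+v_1)$. It acts on $\underline V$ by $(g,v)\cdot(u+a\eta)=gu+av+a\eta$, and it is regarded in this way as a subgroup of $\mathrm{GL}(\underline V)$. Write $e^v=(1,v)$. Let $\mathbf G_m=\mathbb C^\times$ act on $\underline V$ by $c\cdot(u+a\eta)=u+ca\eta$. It normalizes $\underline G$, and $\underline G\rtimes\mathbf G_m$ denotes the subgroup of $\mathrm{GL}(\underline V)$ generated by $\underline G$ and $\mathbf G_m$. Let $\Phi$ be the diagonal representation of $\mathrm{GL}(\underline V)$ on $\underline V^{\otimes r}$, and let $\Psi$ be the place permutation representation of $\mathfrak S_r$, $\Psi(\sigma)(u_1\otimes\cdots\otimes u_r)=u_{\sigma^{-1}(1)}\otimes\cdots\otimes u_{\sigma^{-1}(r)}$. Let $\mathbb C\Phi(\underline G\rtimes\mathbf G_m)$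 and $\mathbb C\Psi(\mathfrak S_r)$ be the subalgebras of $\mathrm{End}_{\mathbb C}(\underline V^{\otimes r})$ generated by the images. *The degenerate double Hecke algebra.* Write $s_i=(i,i+1)$. Let $\mathcal H_r$ be the associative unital $\mathbb C$-algebra with generators $\mathbf s_i$ ($1\le i\le r-1$) and $\mathbf x^{(l)}_\sigma$ ($0\le l\le r$, $\sigma\in\mathfrak S_l$) and the relations - $\mathbf s_i^2=1$; $\ \mathbf s_i\mathbf s_j=\mathbf s_j\mathbf s_i$ if $|i-j|>1$; $\ \mathbf s_i\mathbf s_j\mathbf s_i=\mathbf s_j\mathbf s_i\mathbf s_j$ if $|i-j|=1$; - $\mathbf x^{(l)}_\sigma\mathbf x^{(l)}_\mu=\mathbf x^{(l)}_{\sigma\mu}$; $\ \mathbf x^{(l)}_\delta\mathbf x^{(k)}_\gamma=0$ if $k\ne l$; - $\mathbf s_i\mathbf x^{(l)}_\sigma=\mathbf x^{(l)}_{s_i\sigma}$ and $\mathbf x^{(l)}_\sigma\mathbf s_i=\mathbf x^{(l)}_{\sigma s_i}$ if $i<l$; $\ \mathbf s_i\mathbf x^{(l)}_\sigma=\mathbf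 x^{(l)}_\sigma=\mathbf x^{(l)}_\sigma\mathbf s_i$ if $i>l$. For $I\subset\{1,\dots,r\}$ let $\underline V^{\otimes r}_I\subset\underline V^{\otimes r}$ be the tensor product with the factor $V$ in the places of $I$ and the factor $\mathbb C\eta$ in the other places, so that $\underline V^{\otimes r}=\bigoplus_I\underline V^{\otimes r}_I$. There is a representation $\Xi$ of $\mathcal H_r$ on $\underline V^{\otimes r}$ such that $\Xi(\mathbf s_i)=\Psi(s_i)$, and such that $\Xi(\mathbf x^{(l)}_\sigma)$ permutes the first $l$ places by $\sigma$ on $\underline V^{\otimes r}_{\{1,\dots,l\}}=V^{\otimes l}\otimes\eta^{\otimes (r-l)}$ (that is, it acts there as $\Psi$ of $\sigma$ extended by the identity) and is zero on $\underline V^{\otimes r}_I$ for every $I\ne\{1,\dots,l\}$. Put $D(n,r)=\Xi(\mathcal H_r)$ and $$D(n,r)^V=\{\phi\in D(n,r)\mid \Phi(e^{v})\,\phi\,\Phi(e^{-v})=\phi\ \text{ for all } v\in V\},$$ $$D(n,r)_{\mathrm{ann}}=\{\phi\in D(n,r)\mid \phi(w)=0\ \text{ for all } w\in(\underline V^{\otimes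 r})^{\mathfrak S_r}\}.$$ Then: 1. the centralizer of $\mathbb C\Phi(\underline G\rtimes\mathbf G_m)$ in $\mathrm{End}_{\mathbb C}(\underline V^{\otimes r})$ is $D(n,r)^V$; 2. $\mathbb C\Psi(\mathfrak S_r)\subset D(n,r)^V\subset\mathbb C\Psi(\mathfrak S_r)+D(n,r)_{\mathrm{ann}}$. -/

import Mathlib

open scoped TensorProduct

namespace EnhancedSchurWeyl

noncomputable section

/-! ### The enhanced group of `GL(V)` -/

/-- The underlying set `GL(V) × V` of the enhanced group of `GL(V)`. -/
@[ext]
structure EnhancedGL (V : Type*) [AddCommGroup V] [Module ℂ V] where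
  /-- the component in `GL(V)` -/
  lin : V ≃ₗ[ℂ] V
  /-- the component in `V` -/
  vec : V

namespace EnhancedGL

variable {V : Type*} [AddCommGroup V] [Module ℂ V]

/-- The enhanced cross product `(g₁, v₁) (g₂, v₂) = (g₁ g₂, g₁ v₂ + v₁)`. -/
instance : Mul (EnhancedGL V) := ⟨fun a b => ⟨a.lin * b.lin, a.lin b.vec + a.vec⟩⟩

instance : One (EnhancedGL V) := ⟨⟨1, 0⟩⟩

instance : Inv (EnhancedGL V) := ⟨fun a => ⟨a.lin⁻¹, -(a.lin⁻¹ a.vec)⟩⟩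

@[simp] lemma mul_lin (a b : EnhancedGL V) : (a * b).lin = a.lin * b.lin := rfl
@[simp] lemma mul_vec (a b : EnhancedGL V) : (a * b).vec = a.lin b.vec + a.vec := rfl
@[simp] lemma one_lin : (1 : EnhancedGL V).lin = 1 := rfl
@[simp] lemma one_vec : (1 : EnhancedGL V).vec = 0 := rfl
@[simp] lemma inv_lin (a : EnhancedGL V) : (a⁻¹).lin = a.lin⁻¹ := rfl
@[simp] lemma inv_vec (a : EnhancedGL V) : (a⁻¹).vec = -(a.lin⁻¹ a.vec) := rfl

instance : Group (EnhancedGL V) :=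
  Group.ofLeftAxioms
    (fun a b c => by ext <;> simp [mul_assoc, add_assoc])
    (fun a => by ext <;> simp)
    (fun a => by ext <;> simp)

/-- The element `e^v = (1, v)` of the enhanced group. -/
def exp (v : V) : EnhancedGL V := ⟨1, v⟩

@[simp] lemma exp_lin (v : V) : (exp v).lin = 1 := rfl
@[simp] lemma exp_vec (v : V) : (exp v).vec = v := rfl

lemma exp_add (v w : V) : exp v * exp w = exp (v + w) := by
  ext <;> simp [add_comm]

lemma exp_zero : exp (0 : V) = 1 := rfl

end EnhancedGL

variable (V : Type*) [AddCommGroup V] [Module ℂ V]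

/-- The natural representation of the enhanced group on the enhanced space `V ⊕ ℂ η`, realised as
`V × ℂ` with `η = (0, 1)`: the pair `(g, v)` sends `u + a η` to `g u + a v + a η`. -/
def enhancedHom : EnhancedGL V →* ((V × ℂ) ≃ₗ[ℂ] (V × ℂ)) where
  toFun a :=
    { toFun := fun u => (a.lin u.1 + u.2 • a.vec, u.2)
      map_add' := fun u w => by
        ext
        · simp [add_smul]; abel
        · simp
      map_smul' := fun c u => by
        ext
        · simp [mul_smul]
        · simp
      invFun := fun u => (a.lin⁻¹ (u.1 - u.2 • a.vec), u.2)
      left_inv := fun u => by ext <;> simp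
      right_inv := fun u => by ext <;> simp }
  map_one' := by ext u <;> simp
  map_mul' a b := by
    ext u <;> simp [add_assoc]

/-- The embedding of the multiplicative group `ℂˣ` in `GL(V ⊕ ℂ η)` as `c ↦ diag(1, …, 1, c)`. -/
def multHom : ℂˣ →* ((V × ℂ) ≃ₗ[ℂ] (V × ℂ)) where
  toFun c :=
    { toFun := fun u => (u.1, (c : ℂ) * u.2)
      map_add' := fun u w => by ext <;> simp [mul_add]
      map_smul' := fun b u => by
        ext
        · simp
        · simp [mul_left_comm]
      invFun := fun u => (u.1, ((c⁻¹ : ℂˣ) : ℂ) * u.2)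
      left_inv := fun u => by ext <;> simp
      right_inv := fun u => by ext <;> simp }
  map_one' := by ext u <;> simp
  map_mul' a b := by ext u <;> simp [mul_assoc]

/-- The parabolic subgroup of `GL(V ⊕ ℂ η)` generated by the enhanced group and by `ℂˣ`. The second
factor normalises the first, and this is their semidirect product. -/
def parabolic : Subgroup ((V × ℂ) ≃ₗ[ℂ] (V × ℂ)) :=
  (enhancedHom V).range ⊔ (multHom V).range

/-! ### The tensor space and the actions on it -/

/-- The enhanced tensor space `(V ⊕ ℂ η)^{⊗ r}`. -/
abbrev TensorSpace (r : ℕ) : Type _ := ⨂[ℂ] _ : Fin r, (V × ℂ)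

/-- The diagonal representation `Φ` of `GL(V ⊕ ℂ η)` on the tensor space. -/
def Phi (r : ℕ) : Representation ℂ ((V × ℂ) ≃ₗ[ℂ] (V × ℂ)) (TensorSpace V r) where
  toFun g := PiTensorProduct.map fun _ => (g : (V × ℂ) →ₗ[ℂ] (V × ℂ))
  map_one' := PiTensorProduct.map_one
  map_mul' g h := PiTensorProduct.map_mul (fun _ => (g : (V × ℂ) →ₗ[ℂ] (V × ℂ)))
    (fun _ => (h : (V × ℂ) →ₗ[ℂ] (V × ℂ)))

/-- The place permutation representation `Ψ` of the symmetric group on the tensor space: `σ` sends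
`v₁ ⊗ ⋯ ⊗ v_r` to the tensor whose `i`-th factor is that of index `σ⁻¹ i`. -/
def Psi (r : ℕ) : Representation ℂ (Equiv.Perm (Fin r)) (TensorSpace V r) where
  toFun σ := (PiTensorProduct.reindex ℂ (fun _ => V × ℂ) σ).toLinearMap
  map_one' := by
    ext v
    simp only [LinearMap.compMultilinearMap_apply, LinearEquiv.coe_coe,
      PiTensorProduct.reindex_tprod]
    rfl
  map_mul' σ τ := by
    ext v
    simp only [LinearMap.compMultilinearMap_apply, LinearEquiv.coe_coe, Module.End.mul_apply,
      PiTensorProduct.reindex_tprod]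
    rfl

lemma Psi_tprod (r : ℕ) (σ : Equiv.Perm (Fin r)) (v : Fin r → V × ℂ) :
    Psi V r σ (PiTensorProduct.tprod ℂ v) = PiTensorProduct.tprod ℂ fun i => v (σ.symm i) :=
  PiTensorProduct.reindex_tprod (s := fun _ => V × ℂ) σ v

/-- The subalgebra of `End((V ⊕ ℂ η)^{⊗ r})` generated by the image of the parabolic subgroup. -/
def parabolicSchur (r : ℕ) : Subalgebra ℂ (Module.End ℂ (TensorSpace V r)) :=
  Algebra.adjoin ℂ (Phi V r '' (parabolic V : Set ((V × ℂ) ≃ₗ[ℂ] (V × ℂ))))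

/-- The subalgebra of `End((V ⊕ ℂ η)^{⊗ r})` generated by the place permutations. -/
def permAlgebra (r : ℕ) : Subalgebra ℂ (Module.End ℂ (TensorSpace V r)) :=
  Algebra.adjoin ℂ (Set.range (Psi V r))

/-! ### The degenerate double Hecke algebra -/

/-- The transposition of the `i`-th and the `(i+1)`-st of the `m` points (counted from `0`). -/
def adjSwap (m i : ℕ) (hi : i + 1 < m) : Equiv.Perm (Fin m) :=
  Equiv.swap ⟨i, Nat.lt_of_succ_lt hi⟩ ⟨i + 1, hi⟩

/-- The generators of the degenerate double Hecke algebra. Positions are counted from `0`, so that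
`s i` stands for the generator usually written with the index `i + 1`. -/
inductive DDHAGen (r : ℕ) : Type
  | s (i : ℕ) (hi : i + 1 < r) : DDHAGen r
  | x (l : ℕ) (hl : l ≤ r) (σ : Equiv.Perm (Fin l)) : DDHAGen r

/-- The generator `s i` in the free algebra. -/
abbrev freeS {r : ℕ} (i : ℕ) (hi : i + 1 < r) : FreeAlgebra ℂ (DDHAGen r) :=
  FreeAlgebra.ι ℂ (DDHAGen.s i hi)

/-- The generator `x_σ^{(l)}` in the free algebra. -/
abbrev freeX {r : ℕ} (l : ℕ) (hl : l ≤ r) (σ : Equiv.Perm (Fin l)) : FreeAlgebra ℂ (DDHAGen r) :=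
  FreeAlgebra.ι ℂ (DDHAGen.x l hl σ)

/-- The defining relations of the degenerate double Hecke algebra. With positions counted from `0`,
`s i` moves the positions `i` and `i + 1`, so that it permutes the first `l` positions among
themselves if `i + 1 < l`, and fixes each of them if `l ≤ i`. -/
inductive DDHARel (r : ℕ) : FreeAlgebra ℂ (DDHAGen r) → FreeAlgebra ℂ (DDHAGen r) → Prop
  | s_sq (i : ℕ) (hi : i + 1 < r) : DDHARel r (freeS i hi * freeS i hi) 1
  | s_comm (i j : ℕ) (hi : i + 1 < r) (hj : j + 1 < r) (hij : i + 1 < j) :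
      DDHARel r (freeS i hi * freeS j hj) (freeS j hj * freeS i hi)
  | s_braid (i : ℕ) (hi : i + 1 < r) (hi' : i + 1 + 1 < r) :
      DDHARel r (freeS i hi * freeS (i + 1) hi' * freeS i hi)
        (freeS (i + 1) hi' * freeS i hi * freeS (i + 1) hi')
  | x_mul (l : ℕ) (hl : l ≤ r) (σ μ : Equiv.Perm (Fin l)) :
      DDHARel r (freeX l hl σ * freeX l hl μ) (freeX l hl (σ * μ))
  | s_mul_x (l : ℕ) (hl : l ≤ r) (σ : Equiv.Perm (Fin l)) (i : ℕ) (hi : i + 1 < r)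
      (hil : i + 1 < l) :
      DDHARel r (freeS i hi * freeX l hl σ) (freeX l hl (adjSwap l i hil * σ))
  | x_mul_s (l : ℕ) (hl : l ≤ r) (σ : Equiv.Perm (Fin l)) (i : ℕ) (hi : i + 1 < r)
      (hil : i + 1 < l) :
      DDHARel r (freeX l hl σ * freeS i hi) (freeX l hl (σ * adjSwap l i hil))
  | s_mul_x_fix (l : ℕ) (hl : l ≤ r) (σ : Equiv.Perm (Fin l)) (i : ℕ) (hi : i + 1 < r)
      (hil : l ≤ i) :
      DDHARel r (freeS i hi * freeX l hl σ) (freeX l hl σ)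
  | x_mul_s_fix (l : ℕ) (hl : l ≤ r) (σ : Equiv.Perm (Fin l)) (i : ℕ) (hi : i + 1 < r)
      (hil : l ≤ i) :
      DDHARel r (freeX l hl σ * freeS i hi) (freeX l hl σ)
  | x_orth (l k : ℕ) (hl : l ≤ r) (hk : k ≤ r) (hkl : k ≠ l) (δ : Equiv.Perm (Fin l))
      (γ : Equiv.Perm (Fin k)) :
      DDHARel r (freeX l hl δ * freeX k hk γ) 0

/-- The degenerate double Hecke algebra of the symmetric group on `r` letters. -/
abbrev DDHA (r : ℕ) : Type := RingQuot (DDHARel r)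

/-! ### Its representation on the tensor space -/

/-- The projection of `V ⊕ ℂ η` onto `V` along `ℂ η`. -/
def projV : (V × ℂ) →ₗ[ℂ] (V × ℂ) := LinearMap.inl ℂ V ℂ ∘ₗ LinearMap.fst ℂ V ℂ

/-- The projection of `V ⊕ ℂ η` onto `ℂ η` along `V`. -/
def projEta : (V × ℂ) →ₗ[ℂ] (V × ℂ) := LinearMap.inr ℂ V ℂ ∘ₗ LinearMap.snd ℂ V ℂ

/-- The factors of `projFirst`. -/
def projFactor (r l : ℕ) (i : Fin r) : (V × ℂ) →ₗ[ℂ] (V × ℂ) :=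
  if (i : ℕ) < l then projV V else projEta V

/-- The projection of the tensor space onto its summand `V^{⊗ l} ⊗ η^{⊗ (r - l)}`, which kills the
summands with factors `V` in the places of any other subset of the places, and `η` elsewhere. -/
def projFirst (r l : ℕ) : Module.End ℂ (TensorSpace V r) :=
  PiTensorProduct.map (projFactor V r l)

/-- A permutation of the first `l` of `r` points, extended by the identity. -/
def extendPerm {r l : ℕ} (hl : l ≤ r) : Equiv.Perm (Fin l) →* Equiv.Perm (Fin r) :=
  Equiv.Perm.viaEmbeddingHom (Fin.castLEEmb hl)

/-- The operator `x_σ` for a permutation `σ` of the first `l` places: it permutes these places on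
`V^{⊗ l} ⊗ η^{⊗ (r - l)}`, and is zero on the summands with factors `V` in the places of any other
subset of the places, and `η` elsewhere. -/
def xOp {r l : ℕ} (hl : l ≤ r) (σ : Equiv.Perm (Fin l)) : Module.End ℂ (TensorSpace V r) :=
  Psi V r (extendPerm hl σ) * projFirst V r l

/-- The operators by which the generators act. -/
def genOp (r : ℕ) : DDHAGen r → Module.End ℂ (TensorSpace V r)
  | DDHAGen.s i hi => Psi V r (adjSwap r i hi)
  | DDHAGen.x _ hl σ => xOp V hl σ

section relations

variable {V}

lemma extendPerm_lt {r l : ℕ} (hl : l ≤ r) (σ : Equiv.Perm (Fin l)) (i : Fin l) :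
    extendPerm hl σ (Fin.castLE hl i) = Fin.castLE hl (σ i) :=
  Equiv.Perm.viaEmbedding_apply σ (Fin.castLEEmb hl) i

lemma extendPerm_ge {r l : ℕ} (hl : l ≤ r) (σ : Equiv.Perm (Fin l)) (i : Fin r)
    (hi : l ≤ (i : ℕ)) : extendPerm hl σ i = i := by
  refine Equiv.Perm.viaEmbedding_apply_of_notMem σ (Fin.castLEEmb hl) i ?_
  rintro ⟨j, rfl⟩
  have := j.2
  simp at hi
  omega

lemma extendPerm_lt_iff {r l : ℕ} (hl : l ≤ r) (σ : Equiv.Perm (Fin l)) (i : Fin r) :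
    ((extendPerm hl σ i : Fin r) : ℕ) < l ↔ (i : ℕ) < l := by
  by_cases h : (i : ℕ) < l
  · have : i = Fin.castLE hl ⟨i, h⟩ := rfl
    rw [this, extendPerm_lt]
    exact iff_of_true (σ _).2 h
  · rw [extendPerm_ge hl σ i (not_lt.mp h)]

lemma extendPerm_adjSwap {r l : ℕ} (hl : l ≤ r) (i : ℕ) (hi : i + 1 < r) (hil : i + 1 < l) :
    extendPerm hl (adjSwap l i hil) = adjSwap r i hi := by
  ext j
  by_cases h : (j : ℕ) < l
  · have : j = Fin.castLE hl ⟨j, h⟩ := rfl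
    rw [this, extendPerm_lt]
    simp only [adjSwap, Equiv.swap_apply_def, Fin.ext_iff, Fin.val_castLE]
    split_ifs <;> simp
  · rw [extendPerm_ge hl _ j (not_lt.mp h)]
    simp only [adjSwap, Equiv.swap_apply_def, Fin.ext_iff]
    split_ifs <;> omega

lemma adjSwap_fix {r : ℕ} (l i : ℕ) (hi : i + 1 < r) (hil : l ≤ i) (j : Fin r)
    (hj : (j : ℕ) < l) : adjSwap r i hi j = j := by
  simp only [adjSwap, Equiv.swap_apply_def, Fin.ext_iff]
  split_ifs <;> simp <;> omega

lemma Psi_mul_projFirst {r l : ℕ} (τ : Equiv.Perm (Fin r))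
    (hτ : ∀ i, ((τ i : Fin r) : ℕ) < l ↔ (i : ℕ) < l) :
    Psi V r τ * projFirst V r l = projFirst V r l * Psi V r τ := by
  ext v
  simp only [LinearMap.compMultilinearMap_apply, Module.End.mul_apply, projFirst,
    PiTensorProduct.map_tprod, Psi_tprod]
  congr 1
  funext i
  have h := hτ (τ.symm i)
  rw [Equiv.apply_symm_apply] at h
  simp only [projFactor, h]

lemma projFirst_mul_self {r l : ℕ} : projFirst V r l * projFirst V r l = projFirst V r l := by
  ext v
  simp only [LinearMap.compMultilinearMap_apply, Module.End.mul_apply, projFirst,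
    PiTensorProduct.map_tprod]
  congr 1
  funext i
  simp only [projFactor]
  split_ifs <;> simp [projV, projEta]

lemma projFirst_mul_ne {r l k : ℕ} (hl : l ≤ r) (hk : k ≤ r) (h : k ≠ l) :
    projFirst V r l * projFirst V r k = 0 := by
  ext v
  simp only [LinearMap.compMultilinearMap_apply, Module.End.mul_apply, projFirst,
    PiTensorProduct.map_tprod, LinearMap.zero_apply]
  have hm : min l k < r := by omega
  refine MultilinearMap.map_coord_zero _ ⟨min l k, hm⟩ ?_
  simp only [projFactor]
  split_ifs <;> first | omega | simp [projV, projEta]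

lemma Psi_mul_projFirst_of_fix {r l : ℕ} (τ : Equiv.Perm (Fin r))
    (hτ : ∀ i : Fin r, (i : ℕ) < l → τ i = i) :
    Psi V r τ * projFirst V r l = projFirst V r l := by
  have hs : ∀ i : Fin r, (i : ℕ) < l → τ.symm i = i := fun i hi => by
    rw [Equiv.symm_apply_eq, hτ i hi]
  have hs' : ∀ i : Fin r, (τ.symm i : ℕ) < l ↔ (i : ℕ) < l := fun i => by
    constructor
    · intro h
      have := hτ _ h
      rw [Equiv.apply_symm_apply] at this
      rwa [this]
    · intro h
      rwa [hs i h]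
  ext v
  let c : Fin r → ℂ := fun i => if (i : ℕ) < l then 1 else (v i).2
  let u : Fin r → V × ℂ := fun i => if (i : ℕ) < l then ((v i).1, 0) else (0, 1)
  have hv : (fun i => projFactor V r l i (v i)) = fun i => c i • u i := by
    funext i
    simp only [projFactor, c, u]
    split_ifs <;> simp [projV, projEta]
  have hu : (fun i => u (τ.symm i)) = u := by
    funext i
    simp only [u, hs' i]
    split_ifs with h
    · rw [hs i h]
    · rfl
  simp only [LinearMap.compMultilinearMap_apply, Module.End.mul_apply, projFirst,
    PiTensorProduct.map_tprod]
  rw [hv, MultilinearMap.map_smul_univ, map_smul, Psi_tprod, hu]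

lemma xOp_mul {r l : ℕ} (hl : l ≤ r) (σ μ : Equiv.Perm (Fin l)) :
    xOp V hl σ * xOp V hl μ = xOp V hl (σ * μ) := by
  simp only [xOp]
  rw [mul_assoc, ← mul_assoc (projFirst V r l),
    ← Psi_mul_projFirst _ (extendPerm_lt_iff hl μ), mul_assoc (Psi V r (extendPerm hl μ)),
    projFirst_mul_self, ← mul_assoc, ← map_mul, ← map_mul]

lemma xOp_mul_ne {r l k : ℕ} (hl : l ≤ r) (hk : k ≤ r) (h : k ≠ l) (δ : Equiv.Perm (Fin l))
    (γ : Equiv.Perm (Fin k)) : xOp V hl δ * xOp V hk γ = 0 := by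
  simp only [xOp]
  rw [Psi_mul_projFirst _ (extendPerm_lt_iff hk γ), mul_assoc, ← mul_assoc (projFirst V r l),
    projFirst_mul_ne hl hk h, zero_mul, mul_zero]

lemma xOp_comm {r l : ℕ} (hl : l ≤ r) (σ : Equiv.Perm (Fin l)) :
    xOp V hl σ = projFirst V r l * Psi V r (extendPerm hl σ) :=
  Psi_mul_projFirst _ (extendPerm_lt_iff hl σ)

lemma genOp_rel {r : ℕ} {a b : FreeAlgebra ℂ (DDHAGen r)} (h : DDHARel r a b) :
    FreeAlgebra.lift ℂ (genOp V r) a = FreeAlgebra.lift ℂ (genOp V r) b := by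
  induction h with
  | s_sq i hi =>
    simp only [map_mul, FreeAlgebra.lift_ι_apply, genOp, map_one]
    rw [← map_mul, adjSwap, Equiv.swap_mul_self, map_one]
  | s_comm i j hi hj hij =>
    simp only [map_mul, FreeAlgebra.lift_ι_apply, genOp]
    rw [← map_mul, ← map_mul]
    congr 1
    refine (Equiv.Perm.disjoint_swap_swap ?_).commute.eq
    simp [Fin.ext_iff]
    omega
  | s_braid i hi hi' =>
    simp only [map_mul, FreeAlgebra.lift_ι_apply, genOp]
    rw [← map_mul, ← map_mul, ← map_mul, ← map_mul]
    congr 1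
    have h₁ : (⟨i, Nat.lt_of_succ_lt hi⟩ : Fin r) ≠ ⟨i + 1, hi⟩ := by simp [Fin.ext_iff]
    have h₂ : (⟨i, Nat.lt_of_succ_lt hi⟩ : Fin r) ≠ ⟨i + 1 + 1, hi'⟩ := by
      simp [Fin.ext_iff, add_assoc]
    have h₃ : (⟨i + 1, hi⟩ : Fin r) ≠ ⟨i + 1 + 1, hi'⟩ := by simp [Fin.ext_iff]
    have e₁ := Equiv.swap_mul_swap_mul_swap h₁ h₂
    have e₂ := Equiv.swap_mul_swap_mul_swap h₃.symm h₂.symm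
    simp only [adjSwap]
    rw [Equiv.swap_comm (⟨i + 1, hi⟩ : Fin r) ⟨i, Nat.lt_of_succ_lt hi⟩,
      Equiv.swap_comm (⟨i + 1 + 1, hi'⟩ : Fin r) ⟨i + 1, hi⟩] at e₂
    exact e₂.trans ((Equiv.swap_comm _ _).trans e₁.symm)
  | x_mul l hl σ μ =>
    simp only [map_mul, FreeAlgebra.lift_ι_apply, genOp]
    exact xOp_mul hl σ μ
  | s_mul_x l hl σ i hi hil =>
    simp only [map_mul, FreeAlgebra.lift_ι_apply, genOp]
    simp only [xOp]
    rw [← mul_assoc, ← map_mul, map_mul (extendPerm hl), extendPerm_adjSwap hl i hi hil]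
  | x_mul_s l hl σ i hi hil =>
    simp only [map_mul, FreeAlgebra.lift_ι_apply, genOp]
    rw [xOp_comm, xOp_comm, mul_assoc, ← map_mul, map_mul (extendPerm hl),
      extendPerm_adjSwap hl i hi hil]
  | s_mul_x_fix l hl σ i hi hil =>
    simp only [map_mul, FreeAlgebra.lift_ι_apply, genOp]
    rw [xOp_comm, ← mul_assoc, Psi_mul_projFirst_of_fix _ (adjSwap_fix l i hi hil)]
  | x_mul_s_fix l hl σ i hi hil =>
    simp only [map_mul, FreeAlgebra.lift_ι_apply, genOp]
    have hfix := adjSwap_fix l i hi hil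
    have hiff : ∀ j : Fin r, ((adjSwap r i hi j : Fin r) : ℕ) < l ↔ (j : ℕ) < l := fun j => by
      constructor
      · intro h
        rwa [(adjSwap r i hi).injective (hfix _ h)] at h
      · intro h
        rwa [hfix j h]
    rw [xOp, mul_assoc, ← Psi_mul_projFirst _ hiff, Psi_mul_projFirst_of_fix _ hfix]
  | x_orth l k hl hk hkl δ γ =>
    simp only [map_mul, FreeAlgebra.lift_ι_apply, genOp, map_zero]
    exact xOp_mul_ne hl hk hkl δ γ

end relations

/-- The representation `Ξ` of the degenerate double Hecke algebra on the tensor space. -/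
def Xi (r : ℕ) : DDHA r →ₐ[ℂ] Module.End ℂ (TensorSpace V r) :=
  RingQuot.liftAlgHom ℂ ⟨FreeAlgebra.lift ℂ (genOp V r), fun _ _ h => genOp_rel h⟩

/-- The finite-dimensional degenerate double Hecke algebra `D(n, r)`, where `n = dim V`. -/
def finDDHA (r : ℕ) : Subalgebra ℂ (Module.End ℂ (TensorSpace V r)) := (Xi V r).range

/-- The operator of `e^v` on the tensor space. -/
def expOp (r : ℕ) (v : V) : Module.End ℂ (TensorSpace V r) :=
  Phi V r (enhancedHom V (EnhancedGL.exp v))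

lemma expOp_mul_neg (r : ℕ) (v : V) : expOp V r v * expOp V r (-v) = 1 := by
  simp only [expOp]
  rw [← map_mul, ← map_mul, EnhancedGL.exp_add, add_neg_cancel, EnhancedGL.exp_zero, map_one,
    map_one]

lemma expOp_neg_mul (r : ℕ) (v : V) : expOp V r (-v) * expOp V r v = 1 := by
  simpa using expOp_mul_neg V r (-v)

/-- `D(n, r)^V`: the elements of `D(n, r)` that are fixed under conjugation by all `e^v`. -/
def finDDHAInv (r : ℕ) : Subalgebra ℂ (Module.End ℂ (TensorSpace V r)) where
  carrier := {φ | φ ∈ finDDHA V r ∧ ∀ v : V, expOp V r v * φ * expOp V r (-v) = φ}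
  mul_mem' := by
    rintro φ ψ ⟨hφ, hφ'⟩ ⟨hψ, hψ'⟩
    refine ⟨mul_mem hφ hψ, fun v => ?_⟩
    calc expOp V r v * (φ * ψ) * expOp V r (-v)
        = (expOp V r v * φ * expOp V r (-v)) * (expOp V r v * ψ * expOp V r (-v)) := by
          simp only [mul_assoc]
          rw [← mul_assoc (expOp V r (-v)) (expOp V r v), expOp_neg_mul, one_mul]
      _ = φ * ψ := by rw [hφ', hψ']
  add_mem' := by
    rintro φ ψ ⟨hφ, hφ'⟩ ⟨hψ, hψ'⟩
    exact ⟨add_mem hφ hψ, fun v => by rw [mul_add, add_mul, hφ', hψ']⟩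
  algebraMap_mem' c :=
    ⟨(finDDHA V r).algebraMap_mem c, fun v => by
      rw [← Algebra.commutes, mul_assoc, expOp_mul_neg, mul_one]⟩

/-- `D(n, r)_ann`: the elements of `D(n, r)` that kill all invariants of the symmetric group. -/
def finDDHAAnn (r : ℕ) : Submodule ℂ (Module.End ℂ (TensorSpace V r)) where
  carrier := {φ | φ ∈ finDDHA V r ∧ ∀ w ∈ (Psi V r).invariants, φ w = 0}
  add_mem' := by
    rintro φ ψ ⟨hφ, hφ'⟩ ⟨hψ, hψ'⟩
    exact ⟨add_mem hφ hψ, fun w hw => by rw [LinearMap.add_apply, hφ' w hw, hψ' w hw, add_zero]⟩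
  zero_mem' := ⟨zero_mem _, fun _ _ => rfl⟩
  smul_mem' := by
    rintro c φ ⟨hφ, hφ'⟩
    exact ⟨(finDDHA V r).smul_mem hφ c, fun w hw => by
      rw [LinearMap.smul_apply, hφ' w hw, smul_zero]⟩

end

end EnhancedSchurWeyl

open EnhancedSchurWeyl

/-! The parabolic subgroup is generated by its Levi subgroup L = GL(V) × ℂˣ and the elements e^v.
Hence the first claim reduces to showing that D = D(n, r) is exactly the centralizer of L: commuting
with the e^v then cuts out D^V.

D is generated by the place permutations Ψ(σ) and the projections p_s onto the summands indexed by
sets s of places. Both kinds commute with L, which gives one inclusion. For the other, D is shown to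
be its own double centralizer, and the centralizer of D to be spanned by L.

The first point (`mem_of_mem_centralizer_centralizer`) uses the separability idempotent (1/r!) ∑
Ψ(σ) p_s ⊗ p_s Ψ(σ)⁻¹ of D, whose defining property is `average_comm`. For the second
(`mem_span_levi_of_commute`), an operator Z commuting with D equals its own average (1/r!) ∑ Ψ(σ)
p_s Z p_s Ψ(σ)⁻¹. Expanding Z in pure tensors of endomorphisms turns this average into symmetrized
tensors of block diagonal endomorphisms. By polarization these are combinations of powers g ⊗ ⋯ ⊗ g
with g in L, since invertibility fails at only finitely many points of each line in the direction of
the identity.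

For the last inclusion, η^{⊗r} is an eigenvector of all of D. If φ in D^V has eigenvalue c there,
then, commuting with the parabolic subgroup, it multiplies y^{⊗r} by c for every y outside V. These
powers span the symmetric tensors, so φ - c lies in D_ann, while c is in the permutation algebra. -/

namespace EnhancedSchurWeyl

/-! ### Polarization -/

section Polarization

open Finset

variable {K X N ι : Type*} [Field K] [Infinite K] [AddCommGroup X] [Module K X]
  [AddCommGroup N] [Module K N] [Fintype ι] [DecidableEq ι]

/-- A multilinear form that vanishes on the diagonal over a set with finite complement on each line
of a fixed direction vanishes on the whole diagonal. -/
lemma multilinear_diag_eq_zero_of_cofinite (g : MultilinearMap K (fun _ : ι => X) K)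
    (U : Set X) (u₀ : X) (hU : ∀ x, {t : K | x + t • u₀ ∉ U}.Finite)
    (hg : ∀ y ∈ U, g (fun _ => y) = 0) (x : X) : g (fun _ => x) = 0 := by
  -- The multilinear expansion of g on the diagonal at x + t u₀, as a polynomial in t. It has
  -- infinitely many roots, so it vanishes, in particular at t = 0.
  let p : Polynomial K := ∑ s : Finset ι,
    Polynomial.C (g (s.piecewise (fun _ => x) fun _ => u₀)) * Polynomial.X ^ (sᶜ).card
  have hp : ∀ t, p.eval t = g fun _ => x + t • u₀ := fun t => by
    have h := g.map_add_univ (fun _ => x) (fun _ => t • u₀)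
    change g (fun _ => x + t • u₀) = _ at h
    rw [h, Polynomial.eval_finsetSum]
    refine Finset.sum_congr rfl fun s _ => ?_
    have h' := g.map_piecewise_smul (fun _ => t) (s.piecewise (fun _ => x) fun _ => u₀) sᶜ
    rw [Finset.prod_const] at h'
    have e : (sᶜ).piecewise (fun i => t • s.piecewise (fun _ => x) (fun _ => u₀) i)
        (s.piecewise (fun _ => x) fun _ => u₀) =
          s.piecewise (fun _ => x) fun _ => t • u₀ := by
      funext i
      by_cases hi : i ∈ s <;> simp [Finset.piecewise, hi]
    rw [e] at h'
    rw [h']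
    rw [Polynomial.eval_mul, Polynomial.eval_C, Polynomial.eval_pow, Polynomial.eval_X, smul_eq_mul,
      mul_comm]
  have hp0 : p = 0 := by
    refine Polynomial.eq_zero_of_infinite_isRoot p ?_
    refine (Set.Finite.infinite_compl (hU x)).mono fun t ht => ?_
    have ht' : x + t • u₀ ∈ U := by simpa using ht
    change p.eval t = 0
    rw [hp, hg _ ht']
  have := hp 0
  rw [hp0] at this
  simpa using this.symm

/-- This isolates the squarefree monomial of full degree: in the expansion over all p, only
permutations contribute to it. -/
lemma sum_single_comp_eq_iff (p : ι → ι) :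
    (∑ j, Finsupp.single (p j) 1 : ι →₀ ℕ) = ∑ j, Finsupp.single j 1 ↔
      Function.Bijective p := by
  constructor
  · intro h
    refine Finite.surjective_iff_bijective.mp fun i => ?_
    by_contra hi
    push Not at hi
    have := DFunLike.congr_fun h i
    simp [Finsupp.finsetSum_apply, Finsupp.single_apply, hi] at this
  · intro h
    exact h.sum_comp fun j => (Finsupp.single j 1 : ι →₀ ℕ)

/-- A multilinear form that vanishes on the diagonal has zero symmetrization. -/
lemma multilinear_sum_perm_eq_zero_of_diag (g : MultilinearMap K (fun _ : ι => X) K)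
    (hg : ∀ y, g (fun _ => y) = 0) (x : ι → X) :
    ∑ σ : Equiv.Perm ι, g (fun i => x (σ i)) = 0 := by
  -- The value of g on the diagonal at ∑ t_j x_j, as a polynomial in t. The coefficient of ∏ t_j is
  -- the symmetrization.
  let q : MvPolynomial ι K := ∑ p : ι → ι,
    MvPolynomial.monomial (∑ j, Finsupp.single (p j) 1) (g fun i => x (p i))
  have hq : q = 0 := by
    refine MvPolynomial.funext fun t => ?_
    have h := g.map_sum (fun _ j => t j • x j)
    rw [hg] at h
    rw [map_zero, h, map_sum]
    refine Finset.sum_congr rfl fun p _ => ?_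
    rw [g.map_smul_univ, MvPolynomial.eval_monomial, Finsupp.prod, smul_eq_mul, mul_comm]
    congr 1
    have : ((∑ j, Finsupp.single (p j) 1 : ι →₀ ℕ)).prod (fun n e => t n ^ e) = ∏ j, t (p j) := by
      rw [← Finsupp.prod_finsetSum_index (by simp) (by simp [pow_add])]
      simp
    exact this
  have hc := congrArg (MvPolynomial.coeff (∑ j, Finsupp.single j 1)) hq
  simp only [q, MvPolynomial.coeff_sum, MvPolynomial.coeff_monomial, MvPolynomial.coeff_zero,
    sum_single_comp_eq_iff] at hc
  rw [← hc, ← Finset.sum_filter]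
  refine Finset.sum_bij (fun σ _ => σ) (fun σ _ => by simp)
    (fun σ _ τ _ h => DFunLike.coe_injective h) (fun p hp => ?_) (fun _ _ => rfl)
  exact ⟨Equiv.ofBijective p (by simpa using hp), mem_univ _, rfl⟩

/-- Polarization: a symmetrized value of a multilinear map is in the span of the values on the
diagonal over any set with finite complement on each line of a fixed direction. -/
lemma multilinear_sum_perm_mem_span_diag (f : MultilinearMap K (fun _ : ι => X) N)
    (U : Set X) (u₀ : X) (hU : ∀ x, {t : K | x + t • u₀ ∉ U}.Finite) (x : ι → X) :
    ∑ σ : Equiv.Perm ι, f (fun i => x (σ i)) ∈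
      Submodule.span K ((fun y => f fun _ => y) '' U) := by
  -- A linear functional that kills the span but not the given vector reduces the claim to
  -- scalar-valued forms.
  by_contra h
  obtain ⟨φ, hφ, hle⟩ := Submodule.exists_le_ker_of_notMem h
  apply hφ
  have h₁ := multilinear_diag_eq_zero_of_cofinite (φ.compMultilinearMap f) U u₀ hU
    fun y hy => hle (Submodule.subset_span ⟨y, hy, rfl⟩)
  simpa using multilinear_sum_perm_eq_zero_of_diag (φ.compMultilinearMap f) h₁ x

end Polarization

/-! ### The double centralizer of an algebra with an averaging family -/

section DoubleCentralizer

variable {K M ι : Type*} [Field K] [AddCommGroup M] [Module K M] [Module.Finite K M] [Fintype ι]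

/-- An algebra of endomorphisms of a finite-dimensional space that has a separability idempotent
`∑ i, a i ⊗ b i` contains its double centralizer. -/
lemma mem_of_mem_centralizer_centralizer (A : Subalgebra K (Module.End K M))
    (a b : ι → Module.End K M) (ha : ∀ i, a i ∈ A) (hb : ∀ i, b i ∈ A) (hab : ∑ i, a i * b i = 1)
    (hcomm : ∀ (F : Module.End K M →ₗ[K] Module.End K M), ∀ x ∈ A, ∀ Y,
      ∑ i, a i * F (b i * (x * Y)) = x * ∑ i, a i * F (b i * Y))
    {z : Module.End K M}
    (hz : ∀ y : Module.End K M, (∀ x ∈ A, x * y = y * x) → y * z = z * y) : z ∈ A := by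
  obtain ⟨F, hF⟩ := (Subalgebra.toSubmodule A).exists_isCompl
  let π : Module.End K M →ₗ[K] Module.End K M :=
    (Subalgebra.toSubmodule A).subtype ∘ₗ (Subalgebra.toSubmodule A).projectionOnto F hF
  have hπA : ∀ Y, π Y ∈ A := fun Y => Subtype.property (p := (· ∈ Subalgebra.toSubmodule A)) _
  have hπ : ∀ Y ∈ A, π Y = Y := fun Y hY => by
    have := Submodule.projectionOnto_apply_left hF ⟨Y, hY⟩
    simp only [π, LinearMap.comp_apply]
    exact congrArg Subtype.val this
  -- Averaging makes the merely K-linear projection π left A-linear. The image stays in A and 1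
  -- stays fixed, so it remains to prove π' z = z.
  let π' : Module.End K M →ₗ[K] Module.End K M :=
    ∑ i, LinearMap.mulLeft K (a i) ∘ₗ π ∘ₗ LinearMap.mulLeft K (b i)
  have hπ' : ∀ Y, π' Y = ∑ i, a i * π (b i * Y) := fun Y => by simp [π']
  have h1 : π' 1 = 1 := by
    rw [hπ', ← hab]
    exact Finset.sum_congr rfl fun i _ => by rw [hab, mul_one, hπ _ (hb i)]
  have hmem : ∀ Y, π' Y ∈ A := fun Y => by
    rw [hπ']
    exact sum_mem fun i _ => mul_mem (ha i) (hπA _)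
  have hlin : ∀ x ∈ A, ∀ Y, π' (x * Y) = x * π' Y := fun x hx Y => by
    rw [hπ', hπ', hcomm π x hx]
  have hrank : ∀ (ξ : M →ₗ[K] K) (m : M),
      π' (z * ξ.smulRight m) = z * π' (ξ.smulRight m) := fun ξ m => by
    ext w
    -- Sending u to the value at w of π' (ξ ⊗ u) is A-linear in u, hence commutes with z. So π'
    -- commutes with left multiplication by z on rank-one operators, although z is not yet known to
    -- be in A.
    let y : Module.End K M :=
      LinearMap.applyₗ w ∘ₗ π' ∘ₗ LinearMap.smulRightₗ ξ
    have hy : ∀ u, y u = π' (ξ.smulRight u) w := fun u => rfl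
    have hyx : ∀ x ∈ A, x * y = y * x := fun x hx => by
      ext u
      have e : ξ.smulRight (x u) = x * ξ.smulRight u := by ext; simp
      rw [Module.End.mul_apply, Module.End.mul_apply, hy, hy, e, hlin x hx, Module.End.mul_apply]
    have e : ξ.smulRight (z m) = z * ξ.smulRight m := by ext; simp
    have := LinearMap.congr_fun (hz y hyx) m
    rwa [Module.End.mul_apply, Module.End.mul_apply, hy, hy, e] at this
  have hone : ∑ j, ((Module.finBasis K M).coord j).smulRight (Module.finBasis K M j) =
      (1 : Module.End K M) := by
    ext u
    simp [(Module.finBasis K M).sum_repr u]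
  have : π' z = z := by
    conv_lhs => rw [← mul_one z, ← hone, Finset.mul_sum, map_sum]
    simp only [hrank]
    rw [← Finset.mul_sum, ← map_sum, hone, h1, mul_one]
  exact this ▸ hmem z

end DoubleCentralizer

/-! ### Endomorphisms of a tensor power -/

section TensorEnd

variable {K X ι : Type*} [Field K] [AddCommGroup X] [Module K X] [Module.Finite K X] [Fintype ι]

/-- The endomorphisms of a tensor power are spanned by the tensor products of endomorphisms. -/
lemma span_range_map_eq_top :
    Submodule.span K (Set.range fun f : ι → Module.End K X => PiTensorProduct.map f) =
      (⊤ : Submodule K (Module.End K (⨂[K] _ : ι, X))) := by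
  classical
  refine eq_top_iff.mpr fun Z _ => ?_
  let b := Module.finBasis K X
  have hone : ∑ j, (b.coord j).smulRight (b j) = (1 : Module.End K X) := by
    ext u
    simp [b.sum_repr u]
  have hone' : (1 : Module.End K (⨂[K] _ : ι, X)) = ∑ p : ι → Fin (Module.finrank K X),
      PiTensorProduct.map fun i => (b.coord (p i)).smulRight (b (p i)) := by
    rw [← PiTensorProduct.map_one, ← hone]
    exact (PiTensorProduct.mapMultilinear K (fun _ : ι => X) (fun _ => X)).map_sum _
  -- Z becomes a sum of rank-one operators whose functionals are products of coordinates. Expanding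
  -- their image vectors into pure tensors makes each a combination of tensor products of rank-one
  -- maps.
  rw [← mul_one Z, hone', Finset.mul_sum]
  refine sum_mem fun p _ => ?_
  let ξ : (⨂[K] _ : ι, X) →ₗ[K] K := PiTensorProduct.lift
    ((MultilinearMap.mkPiAlgebra K ι K).compLinearMap fun i => b.coord (p i))
  have hξ : ∀ v : ι → X, (PiTensorProduct.map fun i => (b.coord (p i)).smulRight (v i)) =
      ξ.smulRight (PiTensorProduct.tprod K v) := fun v => by
    ext w
    simp [ξ, MultilinearMap.map_smul_univ]
  have hspan : ∀ w, ξ.smulRight w ∈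
      Submodule.span K (Set.range fun f : ι → Module.End K X => PiTensorProduct.map f) := by
    intro w
    have hw : w ∈ Submodule.span K (Set.range (PiTensorProduct.tprod K (s := fun _ : ι => X))) := by
      rw [PiTensorProduct.span_tprod_eq_top]; trivial
    induction hw using Submodule.span_induction with
    | mem w h =>
      obtain ⟨v, rfl⟩ := h
      rw [← hξ]
      exact Submodule.subset_span ⟨_, rfl⟩
    | zero => simp
    | add w w' _ _ h h' =>
      have : ξ.smulRight (w + w') = ξ.smulRight w + ξ.smulRight w' := by ext; simp
      rw [this]; exact add_mem h h'
    | smul c w _ h =>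
      have : ξ.smulRight (c • w) = c • ξ.smulRight w := by ext; simp [smul_comm c]
      rw [this]; exact Submodule.smul_mem _ _ h
  have e : Z * ξ.smulRight (PiTensorProduct.tprod K fun i => b (p i)) =
      ξ.smulRight (Z (PiTensorProduct.tprod K fun i => b (p i))) := by
    ext; simp
  rw [hξ, e]
  exact hspan _

end TensorEnd

/-! ### Place permutations and place projections -/

section Operators

variable {V : Type*} [AddCommGroup V] [Module ℂ V] {r : ℕ}

/-- The projection of the tensor space onto the summand with factors `V` in the places of `s` and
factors `ℂ η` in the other places. -/
noncomputable def placeProj (V : Type*) [AddCommGroup V] [Module ℂ V] {r : ℕ}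
    (s : Finset (Fin r)) : Module.End ℂ (TensorSpace V r) :=
  PiTensorProduct.map fun i => if i ∈ s then projV V else projEta V

lemma Psi_mul_map (σ : Equiv.Perm (Fin r)) (f : Fin r → Module.End ℂ (V × ℂ)) :
    Psi V r σ * PiTensorProduct.map f =
      (PiTensorProduct.map fun i => f (σ.symm i)) * Psi V r σ := by
  ext v
  simp only [LinearMap.compMultilinearMap_apply, Module.End.mul_apply,
    PiTensorProduct.map_tprod, Psi_tprod]

lemma Psi_mul_map_mul_Psi_inv (σ : Equiv.Perm (Fin r)) (f : Fin r → Module.End ℂ (V × ℂ)) :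
    Psi V r σ * PiTensorProduct.map f * Psi V r σ⁻¹ =
      PiTensorProduct.map fun i => f (σ⁻¹ i) := by
  rw [Psi_mul_map, mul_assoc, ← map_mul, mul_inv_cancel, map_one, mul_one]
  rfl

lemma Psi_mul_Phi (σ : Equiv.Perm (Fin r)) (g : (V × ℂ) ≃ₗ[ℂ] (V × ℂ)) :
    Psi V r σ * Phi V r g = Phi V r g * Psi V r σ :=
  Psi_mul_map σ fun _ => (g : (V × ℂ) →ₗ[ℂ] (V × ℂ))

lemma Psi_mul_placeProj (σ : Equiv.Perm (Fin r)) (s : Finset (Fin r)) :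
    Psi V r σ * placeProj V s = placeProj V (s.map σ.toEmbedding) * Psi V r σ := by
  simp only [placeProj, Psi_mul_map, Finset.mem_map_equiv]

lemma placeProj_mul (s t : Finset (Fin r)) :
    placeProj V s * placeProj V t = if s = t then placeProj V s else 0 := by
  rw [placeProj, placeProj, ← PiTensorProduct.map_mul]
  split_ifs with h
  · subst h
    congr 1
    funext i
    split_ifs <;> ext <;> simp [projV, projEta]
  · obtain ⟨i, hi⟩ : ∃ i, ¬(i ∈ s ↔ i ∈ t) := not_forall.mp fun hne => h (Finset.ext hne)
    refine (PiTensorProduct.mapMultilinear ℂ (fun _ : Fin r => V × ℂ)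
      (fun _ => V × ℂ)).map_coord_zero i ?_
    by_cases hs : i ∈ s <;> by_cases ht : i ∈ t <;>
      simp only [hs, ht, if_true, if_false, iff_self, not_true_eq_false] at hi ⊢ <;>
      ext <;> simp [projV, projEta]

lemma sum_placeProj : ∑ s : Finset (Fin r), placeProj V s = 1 := by
  have h := (PiTensorProduct.mapMultilinear ℂ (fun _ : Fin r => V × ℂ)
    (fun _ => V × ℂ)).map_add_univ (fun _ => projV V) (fun _ => projEta V)
  have e : (fun _ : Fin r => projV V) + (fun _ => projEta V) = fun _ => 1 := by
    funext i
    ext <;> simp [projV, projEta]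
  rw [e] at h
  refine Eq.trans ?_ (h.symm.trans PiTensorProduct.map_one)
  refine Finset.sum_congr rfl fun s _ => ?_
  rw [PiTensorProduct.mapMultilinear_apply, placeProj]
  rfl

/-! ### The finite-dimensional degenerate double Hecke algebra -/

lemma genOp_mem_finDDHA (x : DDHAGen r) : genOp V r x ∈ finDDHA V r := by
  refine ⟨RingQuot.mkAlgHom ℂ (DDHARel r) (FreeAlgebra.ι ℂ x), ?_⟩
  change Xi V r _ = _
  rw [Xi, RingQuot.liftAlgHom_mkAlgHom_apply, FreeAlgebra.lift_ι_apply]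

lemma finDDHA_le {C : Subalgebra ℂ (Module.End ℂ (TensorSpace V r))}
    (hC : ∀ x, genOp V r x ∈ C) : finDDHA V r ≤ C := by
  rintro _ ⟨y, rfl⟩
  obtain ⟨a, rfl⟩ := RingQuot.mkAlgHom_surjective ℂ (DDHARel r) y
  change Xi V r _ ∈ C
  rw [Xi, RingQuot.liftAlgHom_mkAlgHom_apply]
  induction a using FreeAlgebra.induction with
  | grade0 c => rw [AlgHom.commutes]; exact C.algebraMap_mem c
  | grade1 x => rw [FreeAlgebra.lift_ι_apply]; exact hC x
  | mul a b ha hb => rw [map_mul]; exact mul_mem ha hb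
  | add a b ha hb => rw [map_add]; exact add_mem ha hb

lemma Psi_mem_finDDHA (σ : Equiv.Perm (Fin r)) : Psi V r σ ∈ finDDHA V r := by
  rcases r with _ | m
  · rw [Subsingleton.elim σ 1, map_one]
    exact one_mem _
  have hσ : σ ∈ Submonoid.closure
      (Set.range fun i : Fin m => Equiv.swap i.castSucc i.succ) := by
    rw [Equiv.Perm.mclosure_swap_castSucc_succ]; trivial
  induction hσ using Submonoid.closure_induction with
  | mem τ h =>
    obtain ⟨i, rfl⟩ := h
    exact genOp_mem_finDDHA (DDHAGen.s (i : ℕ) (by omega))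
  | one => rw [map_one]; exact one_mem _
  | mul σ τ _ _ hσ hτ => rw [map_mul]; exact mul_mem hσ hτ

lemma projFirst_eq_placeProj (l : ℕ) :
    projFirst V r l = placeProj V (Finset.univ.filter fun i : Fin r => (i : ℕ) < l) := by
  simp only [projFirst, placeProj, Finset.mem_filter, Finset.mem_univ, true_and]
  rfl

/-- The generator attached to the identity permutation of the first |s| places is the projection for
those places. Conjugating it by a permutation carrying them onto s gives the rest. -/
lemma placeProj_mem_finDDHA (s : Finset (Fin r)) : placeProj V s ∈ finDDHA V r := by
  have hl : s.card ≤ r := by simpa using s.card_le_univ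
  have hp : projFirst V r s.card ∈ finDDHA V r := by
    have := genOp_mem_finDDHA (V := V) (DDHAGen.x s.card hl 1)
    simpa [genOp, xOp] using this
  let t := Finset.univ.filter fun i : Fin r => (i : ℕ) < s.card
  have ht : t.card = s.card := by
    rw [Fin.card_filter_val_lt, min_eq_right hl]
  obtain ⟨σ, hσ⟩ : ∃ σ : Equiv.Perm (Fin r), t.map σ.toEmbedding = s := by
    let e : {i // i ∈ t} ≃ {i // i ∈ s} := Finset.equivOfCardEq ht
    refine ⟨e.extendSubtype, ?_⟩
    refine Finset.eq_of_subset_of_card_le (fun i hi => ?_) (by rw [Finset.card_map, ht])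
    obtain ⟨j, hj, rfl⟩ := Finset.mem_map.mp hi
    exact e.extendSubtype_mem j hj
  have h := Psi_mul_placeProj (V := V) σ t
  rw [hσ] at h
  have h' : placeProj V s = Psi V r σ * projFirst V r s.card * Psi V r σ⁻¹ := by
    rw [projFirst_eq_placeProj, h, mul_assoc, ← map_mul, mul_inv_cancel, map_one, mul_one]
  rw [h']
  exact mul_mem (mul_mem (Psi_mem_finDDHA _) hp) (Psi_mem_finDDHA _)

lemma finDDHA_le_of_Psi_placeProj {C : Subalgebra ℂ (Module.End ℂ (TensorSpace V r))}
    (h₁ : ∀ σ, Psi V r σ ∈ C) (h₂ : ∀ s, placeProj V s ∈ C) : finDDHA V r ≤ C := by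
  refine finDDHA_le fun x => ?_
  cases x with
  | s i hi => exact h₁ _
  | x l hl σ =>
    refine mul_mem (h₁ _) ?_
    rw [projFirst_eq_placeProj]
    exact h₂ _

/-! ### The action of the Levi subgroup -/

/-- The block diagonal endomorphism of `V ⊕ ℂ η` with given blocks. -/
def blockDiag (V : Type*) [AddCommGroup V] [Module ℂ V] :
    (Module.End ℂ V × ℂ) →ₗ[ℂ] Module.End ℂ (V × ℂ) where
  toFun y := LinearMap.prodMap y.1 (y.2 • LinearMap.id)
  map_add' y z := by ext <;> simp
  map_smul' c y := by ext <;> simp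

@[simp] lemma blockDiag_apply (y : Module.End ℂ V × ℂ) (u : V × ℂ) :
    blockDiag V y u = (y.1 u.1, y.2 * u.2) := by
  simp [blockDiag]

/-- The subgroup `GL(V) × ℂˣ` of the parabolic subgroup, as a parametrised family. -/
def levi (a : V ≃ₗ[ℂ] V) (c : ℂˣ) : (V × ℂ) ≃ₗ[ℂ] (V × ℂ) :=
  enhancedHom V ⟨a, 0⟩ * multHom V c

lemma enhancedHom_mem_parabolic (a : EnhancedGL V) : enhancedHom V a ∈ parabolic V :=
  Subgroup.mem_sup_left ⟨a, rfl⟩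

lemma multHom_mem_parabolic (c : ℂˣ) : multHom V c ∈ parabolic V :=
  Subgroup.mem_sup_right ⟨c, rfl⟩

lemma levi_mem_parabolic (a : V ≃ₗ[ℂ] V) (c : ℂˣ) : levi a c ∈ parabolic V :=
  mul_mem (enhancedHom_mem_parabolic _) (multHom_mem_parabolic c)

lemma coe_levi (a : V ≃ₗ[ℂ] V) (c : ℂˣ) :
    (levi a c : (V × ℂ) →ₗ[ℂ] (V × ℂ)) = blockDiag V (a, c) := by
  ext <;> simp [levi, enhancedHom, multHom]

lemma Phi_levi (a : V ≃ₗ[ℂ] V) (c : ℂˣ) :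
    Phi V r (levi a c) = PiTensorProduct.map fun _ => blockDiag V (a, c) := by
  rw [← coe_levi]
  rfl

lemma blockDiag_mul_placeProj (y : Module.End ℂ V × ℂ) (s : Finset (Fin r)) :
    (PiTensorProduct.map fun _ => blockDiag V y) * placeProj V s =
      placeProj V s * PiTensorProduct.map fun _ => blockDiag V y := by
  rw [placeProj, ← PiTensorProduct.map_mul, ← PiTensorProduct.map_mul]
  congr 1
  funext i
  split_ifs <;> ext <;> simp [projV, projEta]

lemma commute_levi_of_mem_finDDHA {φ : Module.End ℂ (TensorSpace V r)} (hφ : φ ∈ finDDHA V r)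
    (a : V ≃ₗ[ℂ] V) (c : ℂˣ) : Phi V r (levi a c) * φ = φ * Phi V r (levi a c) := by
  have h : finDDHA V r ≤ Subalgebra.centralizer ℂ {Phi V r (levi a c)} := by
    refine finDDHA_le_of_Psi_placeProj (fun σ => ?_) (fun s => ?_)
    · simp only [Subalgebra.mem_centralizer_iff, Set.mem_singleton_iff, forall_eq]
      exact (Psi_mul_Phi σ _).symm
    · simp only [Subalgebra.mem_centralizer_iff, Set.mem_singleton_iff, forall_eq, Phi_levi]
      exact blockDiag_mul_placeProj _ s
  have := h hφ
  simpa only [Subalgebra.mem_centralizer_iff, Set.mem_singleton_iff, forall_eq] using this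

/-- Compression by one projection deletes the off-diagonal blocks in every place, which brings an
arbitrary tensor of endomorphisms within reach of the Levi subgroup. -/
lemma placeProj_mul_map_mul_placeProj (s : Finset (Fin r)) (f : Fin r → Module.End ℂ (V × ℂ)) :
    placeProj V s * PiTensorProduct.map f * placeProj V s =
      PiTensorProduct.map fun i => blockDiag V
        (if i ∈ s then (LinearMap.fst ℂ V ℂ ∘ₗ f i ∘ₗ LinearMap.inl ℂ V ℂ, 0)
          else (0, (f i (0, 1)).2)) := by
  rw [placeProj, ← PiTensorProduct.map_mul, ← PiTensorProduct.map_mul]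
  congr 1
  funext i
  have h₀ : f i (0, 0) = 0 := map_zero (f i)
  split_ifs <;> ext <;> simp [projV, projEta, h₀]

/-- The elements of an algebra whose left multiplication commutes with a linear endomorphism. -/
def leftCommutant {K E : Type*} [CommSemiring K] [Semiring E] [Algebra K E] (T : E →ₗ[K] E) :
    Subalgebra K E where
  carrier := {x | ∀ Y, T (x * Y) = x * T Y}
  mul_mem' := fun {x y} hx hy Y => by
    have hx' : ∀ Y, T (x * Y) = x * T Y := hx
    have hy' : ∀ Y, T (y * Y) = y * T Y := hy
    rw [mul_assoc, hx', hy', mul_assoc]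
  add_mem' := fun {x y} hx hy Y => by
    have hx' : ∀ Y, T (x * Y) = x * T Y := hx
    have hy' : ∀ Y, T (y * Y) = y * T Y := hy
    rw [add_mul, map_add, hx', hy', add_mul]
  algebraMap_mem' := fun c Y => by
    simp only [Algebra.algebraMap_eq_smul_one, smul_mul_assoc, one_mul, map_smul]

/-- It suffices to test generators. A permutation τ is absorbed by the substitution σ ↦ τσ. A
projection p_t, moved past Ψ(σ), meets p_s and by orthogonality selects the same s on both sides. -/
lemma average_comm {x : Module.End ℂ (TensorSpace V r)} (hx : x ∈ finDDHA V r)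
    (F : Module.End ℂ (TensorSpace V r) →ₗ[ℂ] Module.End ℂ (TensorSpace V r))
    (Y : Module.End ℂ (TensorSpace V r)) :
    ∑ σ : Equiv.Perm (Fin r), ∑ s : Finset (Fin r),
        Psi V r σ * placeProj V s * F (placeProj V s * Psi V r σ⁻¹ * (x * Y)) =
      x * ∑ σ : Equiv.Perm (Fin r), ∑ s : Finset (Fin r),
        Psi V r σ * placeProj V s * F (placeProj V s * Psi V r σ⁻¹ * Y) := by
  let T : Module.End ℂ (TensorSpace V r) →ₗ[ℂ] Module.End ℂ (TensorSpace V r) :=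
    ∑ σ : Equiv.Perm (Fin r), ∑ s : Finset (Fin r),
      LinearMap.mulLeft ℂ (Psi V r σ * placeProj V s) ∘ₗ F ∘ₗ
        LinearMap.mulLeft ℂ (placeProj V s * Psi V r σ⁻¹)
  have hT : ∀ Y, T Y = ∑ σ : Equiv.Perm (Fin r), ∑ s : Finset (Fin r),
      Psi V r σ * placeProj V s * F (placeProj V s * Psi V r σ⁻¹ * Y) := fun Y => by
    simp only [T, LinearMap.sum_apply, LinearMap.comp_apply, LinearMap.mulLeft_apply]
  have h : finDDHA V r ≤ leftCommutant T := by
    refine finDDHA_le_of_Psi_placeProj (fun τ Y => ?_) (fun t Y => ?_)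
    · rw [hT, hT, ← Equiv.sum_comp (Equiv.mulLeft τ), Finset.mul_sum]
      refine Finset.sum_congr rfl fun σ _ => ?_
      rw [Finset.mul_sum]
      refine Finset.sum_congr rfl fun s _ => ?_
      rw [Equiv.coe_mulLeft, mul_inv_rev, mul_assoc (placeProj V s) _ (Psi V r τ * Y),
        ← mul_assoc _ (Psi V r τ) Y, ← map_mul, inv_mul_cancel_right, map_mul]
      simp only [mul_assoc]
    · rw [hT, hT, Finset.mul_sum]
      refine Finset.sum_congr rfl fun σ _ => ?_
      rw [Finset.mul_sum]
      refine Finset.sum_congr rfl fun s _ => ?_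
      have e₁ : placeProj V s * Psi V r σ⁻¹ * (placeProj V t * Y) =
          placeProj V s * placeProj V (t.map (σ⁻¹ : Equiv.Perm (Fin r)).toEmbedding) *
            (Psi V r σ⁻¹ * Y) := by
        rw [mul_assoc, ← mul_assoc _ _ Y, Psi_mul_placeProj]
        simp only [mul_assoc]
      have e₂ : placeProj V t * Psi V r σ =
          Psi V r σ * placeProj V (t.map (σ⁻¹ : Equiv.Perm (Fin r)).toEmbedding) := by
        rw [Psi_mul_placeProj, Finset.map_map]
        congr 2
        ext i
        simp
      rw [e₁, ← mul_assoc (placeProj V t), ← mul_assoc (placeProj V t), e₂,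
        mul_assoc (Psi V r σ) (placeProj V (t.map _)), placeProj_mul, placeProj_mul]
      by_cases hs : s = t.map (σ⁻¹ : Equiv.Perm (Fin r)).toEmbedding
      · rw [if_pos hs, if_pos hs.symm, ← hs, mul_assoc (placeProj V s)]
      · rw [if_neg hs, if_neg (Ne.symm hs), zero_mul, map_zero, mul_zero, mul_zero, zero_mul]
  rw [← hT, ← hT]
  exact h hx Y

end Operators

/-! ### The double centralizer of the Levi subgroup -/

section Levi

variable {V : Type*} [AddCommGroup V] [Module ℂ V] [FiniteDimensional ℂ V] {r : ℕ}

/-- An excluded t is the negative of an eigenvalue of the first component or of the second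
component. -/
lemma finite_setOf_not_invertible (x : Module.End ℂ V × ℂ) :
    {t : ℂ | x + t • (1 : Module.End ℂ V × ℂ) ∉
      {y : Module.End ℂ V × ℂ | IsUnit y.1 ∧ y.2 ≠ 0}}.Finite := by
  have h₁ : (Neg.neg ⁻¹' spectrum ℂ x.1).Finite :=
    (Module.End.finite_spectrum x.1).preimage neg_injective.injOn
  refine (h₁.union (Set.finite_singleton (-x.2))).subset fun t ht => ?_
  by_contra hne
  simp only [Set.mem_union, Set.mem_preimage, Set.mem_singleton_iff, not_or,
    spectrum.mem_iff, not_not] at hne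
  refine ht ⟨?_, fun h => hne.2 (eq_neg_of_add_eq_zero_right (by simpa using h))⟩
  have := hne.1.neg
  have e : -((algebraMap ℂ (Module.End ℂ V)) (-t) - x.1) =
      (x + t • (1 : Module.End ℂ V × ℂ)).1 := by
    rw [map_neg, Algebra.algebraMap_eq_smul_one]
    simp
  rwa [e] at this

/-- The symmetrization of a tensor product of block diagonal endomorphisms is a combination of
operators of the Levi subgroup. -/
lemma sum_perm_blockDiag_mem_span (x : Fin r → Module.End ℂ V × ℂ) :
    ∑ σ : Equiv.Perm (Fin r), PiTensorProduct.map (fun i => blockDiag V (x (σ i))) ∈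
      Submodule.span ℂ (Set.range fun p : (V ≃ₗ[ℂ] V) × ℂˣ => Phi V r (levi p.1 p.2)) := by
  let F : MultilinearMap ℂ (fun _ : Fin r => Module.End ℂ V × ℂ)
      (Module.End ℂ (TensorSpace V r)) :=
    (PiTensorProduct.mapMultilinear ℂ (fun _ : Fin r => V × ℂ)
      (fun _ => V × ℂ)).compLinearMap fun _ => blockDiag V
  have h := multilinear_sum_perm_mem_span_diag (K := ℂ) (X := Module.End ℂ V × ℂ)
    (N := Module.End ℂ (TensorSpace V r)) F
    {y : Module.End ℂ V × ℂ | IsUnit y.1 ∧ y.2 ≠ 0} 1 finite_setOf_not_invertible x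
  refine Submodule.span_mono ?_ h
  rintro _ ⟨⟨f, c⟩, ⟨hf, hc⟩, rfl⟩
  obtain ⟨u, rfl⟩ := hf
  refine ⟨(LinearMap.GeneralLinearGroup.generalLinearEquiv ℂ V u, Units.mk0 c hc), ?_⟩
  change Phi V r (levi _ _) = _
  rw [Phi_levi]
  rfl

lemma average_mem_span_levi (Z : Module.End ℂ (TensorSpace V r)) :
    ∑ σ : Equiv.Perm (Fin r), ∑ s : Finset (Fin r),
        Psi V r σ * (placeProj V s * Z * placeProj V s) * Psi V r σ⁻¹ ∈
      Submodule.span ℂ (Set.range fun p : (V ≃ₗ[ℂ] V) × ℂˣ => Phi V r (levi p.1 p.2)) := by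
  have hZ : Z ∈ Submodule.span ℂ
      (Set.range fun f : Fin r → Module.End ℂ (V × ℂ) => PiTensorProduct.map f) := by
    rw [span_range_map_eq_top]; trivial
  induction hZ using Submodule.span_induction with
  | mem Z h =>
    obtain ⟨f, rfl⟩ := h
    rw [Finset.sum_comm]
    refine sum_mem fun s _ => ?_
    simp only [placeProj_mul_map_mul_placeProj, Psi_mul_map_mul_Psi_inv]
    have h := sum_perm_blockDiag_mem_span fun i : Fin r =>
      if i ∈ s then (LinearMap.fst ℂ V ℂ ∘ₗ f i ∘ₗ LinearMap.inl ℂ V ℂ, 0)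
      else (0, (f i (0, 1)).2)
    rwa [← Equiv.sum_comp (Equiv.inv (Equiv.Perm (Fin r)))] at h
  | zero => simp
  | add Z Z' _ _ h h' =>
    simp only [mul_add, add_mul, Finset.sum_add_distrib]
    exact add_mem h h'
  | smul c Z _ h =>
    simp only [mul_smul_comm, smul_mul_assoc, ← Finset.smul_sum]
    exact Submodule.smul_mem _ _ h

/-- The centralizer of the algebra `D(n, r)` is spanned by the operators of the Levi subgroup. -/
lemma mem_span_levi_of_commute {Z : Module.End ℂ (TensorSpace V r)}
    (hZ : ∀ x ∈ finDDHA V r, x * Z = Z * x) :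
    Z ∈ Submodule.span ℂ (Set.range fun p : (V ≃ₗ[ℂ] V) × ℂˣ => Phi V r (levi p.1 p.2)) := by
  have h := average_mem_span_levi Z
  -- As Z commutes with D, it factors out of the average, and the remaining sum is r! times the
  -- identity.
  have e : ∀ (σ : Equiv.Perm (Fin r)) (s : Finset (Fin r)),
      Psi V r σ * (placeProj V s * Z * placeProj V s) * Psi V r σ⁻¹ =
        Z * (Psi V r σ * placeProj V s * Psi V r σ⁻¹) := fun σ s => by
    rw [hZ _ (placeProj_mem_finDDHA s), mul_assoc Z, placeProj_mul, if_pos rfl, ← mul_assoc,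
      hZ _ (Psi_mem_finDDHA σ), mul_assoc, mul_assoc, mul_assoc]
  simp only [e, ← Finset.mul_sum, ← Finset.sum_mul, sum_placeProj, mul_one, ← map_mul,
    mul_inv_cancel, map_one, Finset.sum_const] at h
  rw [Finset.card_univ, Fintype.card_perm, ← Nat.cast_smul_eq_nsmul ℂ] at h
  exact (Submodule.smul_mem_iff _ (Nat.cast_ne_zero.mpr (Nat.factorial_ne_zero _))).mp h

/-- The algebra `D(n, r)` contains the centralizer of the Levi subgroup. -/
lemma mem_finDDHA_of_commute_levi {φ : Module.End ℂ (TensorSpace V r)}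
    (hφ : ∀ (a : V ≃ₗ[ℂ] V) (c : ℂˣ), Phi V r (levi a c) * φ = φ * Phi V r (levi a c)) :
    φ ∈ finDDHA V r := by
  have hr : ((r.factorial : ℕ) : ℂ) ≠ 0 := Nat.cast_ne_zero.mpr (Nat.factorial_ne_zero _)
  refine mem_of_mem_centralizer_centralizer (finDDHA V r)
    (fun p : Equiv.Perm (Fin r) × Finset (Fin r) =>
      ((r.factorial : ℕ) : ℂ)⁻¹ • (Psi V r p.1 * placeProj V p.2))
    (fun p => placeProj V p.2 * Psi V r p.1⁻¹)
    (fun p => Subalgebra.smul_mem _ (mul_mem (Psi_mem_finDDHA _) (placeProj_mem_finDDHA _)) _)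
    (fun p => mul_mem (placeProj_mem_finDDHA _) (Psi_mem_finDDHA _)) ?_ (fun F x hx Y => ?_)
    (fun y hy => ?_)
  · have e : ∀ (σ : Equiv.Perm (Fin r)) (s : Finset (Fin r)),
        Psi V r σ * placeProj V s * (placeProj V s * Psi V r σ⁻¹) =
          Psi V r σ * placeProj V s * Psi V r σ⁻¹ := fun σ s => by
      rw [mul_assoc, ← mul_assoc (placeProj V s), placeProj_mul, if_pos rfl, mul_assoc]
    simp only [smul_mul_assoc, ← Finset.smul_sum, Fintype.sum_prod_type, e, ← Finset.mul_sum,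
      ← Finset.sum_mul, sum_placeProj, mul_one, ← map_mul, mul_inv_cancel, map_one,
      Finset.sum_const]
    rw [Finset.card_univ, Fintype.card_perm, Fintype.card_fin, ← Nat.cast_smul_eq_nsmul ℂ,
      smul_smul, inv_mul_cancel₀ hr, one_smul]
  · simp only [smul_mul_assoc, ← Finset.smul_sum, Fintype.sum_prod_type, mul_smul_comm]
    rw [average_comm hx]
  -- An operator commuting with D is a combination of Levi operators, and φ commutes with those.
  · refine (Submodule.span_le (p := Subalgebra.toSubmodule (Subalgebra.centralizer ℂ {φ}))).mpr ?_
      (mem_span_levi_of_commute hy) φ rfl |>.symm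
    rintro _ ⟨p, rfl⟩ _ rfl
    exact (hφ p.1 p.2).symm

end Levi

/-! ### The centralizer of the parabolic subgroup -/

section Parabolic

variable {V : Type*} [AddCommGroup V] [Module ℂ V] {r : ℕ}

lemma enhancedHom_eq_exp_mul (a : EnhancedGL V) :
    enhancedHom V a = enhancedHom V (EnhancedGL.exp a.vec) * levi a.lin 1 := by
  rw [levi, map_one, mul_one, ← map_mul]
  congr 1
  ext <;> simp

lemma expOp_conj_eq_iff (φ : Module.End ℂ (TensorSpace V r)) (v : V) :
    expOp V r v * φ * expOp V r (-v) = φ ↔ expOp V r v * φ = φ * expOp V r v := by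
  constructor
  · intro h
    conv_rhs => rw [← h]
    rw [mul_assoc _ _ (expOp V r v), expOp_neg_mul, mul_one]
  · intro h
    rw [h, mul_assoc, expOp_mul_neg, mul_one]

lemma commute_of_mem_finDDHAInv {φ : Module.End ℂ (TensorSpace V r)} (hφ : φ ∈ finDDHAInv V r)
    {g : (V × ℂ) ≃ₗ[ℂ] (V × ℂ)} (hg : g ∈ parabolic V) : Phi V r g * φ = φ * Phi V r g := by
  rw [parabolic, Subgroup.sup_eq_closure] at hg
  induction hg using Subgroup.closure_induction with
  | mem g h =>
    rcases h with ⟨a, rfl⟩ | ⟨c, rfl⟩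
    · rw [enhancedHom_eq_exp_mul, map_mul, mul_assoc, commute_levi_of_mem_finDDHA hφ.1,
        ← mul_assoc]
      refine Eq.trans ?_ (mul_assoc _ _ _)
      exact congrArg (· * _) ((expOp_conj_eq_iff φ a.vec).mp (hφ.2 a.vec))
    · have h := commute_levi_of_mem_finDDHA hφ.1 1 c
      have e : levi 1 c = multHom V c := by
        rw [levi, show (⟨1, 0⟩ : EnhancedGL V) = 1 from rfl, map_one, one_mul]
      rwa [e] at h
  | one => rw [map_one, one_mul, mul_one]
  | mul g h _ _ hg hh => rw [map_mul, mul_assoc, hh, ← mul_assoc, hg, mul_assoc]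
  | inv g _ hg =>
    calc Phi V r g⁻¹ * φ = Phi V r g⁻¹ * (φ * Phi V r g) * Phi V r g⁻¹ := by
          rw [mul_assoc, mul_assoc φ, ← map_mul, mul_inv_cancel, map_one, mul_one]
      _ = φ * Phi V r g⁻¹ := by
          rw [← hg, ← mul_assoc, ← map_mul, inv_mul_cancel, map_one, one_mul]

lemma mem_centralizer_parabolicSchur_iff (φ : Module.End ℂ (TensorSpace V r)) :
    φ ∈ Subalgebra.centralizer ℂ (parabolicSchur V r : Set (Module.End ℂ (TensorSpace V r))) ↔
      ∀ g ∈ parabolic V, Phi V r g * φ = φ * Phi V r g := by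
  rw [Subalgebra.mem_centralizer_iff]
  constructor
  · exact fun h g hg => h _ (Algebra.subset_adjoin ⟨g, hg, rfl⟩)
  · intro h x hx
    have hle : parabolicSchur V r ≤ Subalgebra.centralizer ℂ {φ} := by
      refine Algebra.adjoin_le ?_
      rintro _ ⟨g, hg, rfl⟩ _ rfl
      exact (h g hg).symm
    exact (hle hx φ rfl).symm

lemma centralizer_parabolicSchur_eq [FiniteDimensional ℂ V] :
    Subalgebra.centralizer ℂ (parabolicSchur V r : Set (Module.End ℂ (TensorSpace V r))) =
      finDDHAInv V r := by
  ext φ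
  rw [mem_centralizer_parabolicSchur_iff]
  refine ⟨fun h => ⟨?_, fun v => ?_⟩, fun h g hg => commute_of_mem_finDDHAInv h hg⟩
  · exact mem_finDDHA_of_commute_levi fun a c => h _ (levi_mem_parabolic a c)
  · exact (expOp_conj_eq_iff φ v).mpr (h _ (enhancedHom_mem_parabolic _))

lemma permAlgebra_le_finDDHAInv : permAlgebra V r ≤ finDDHAInv V r := by
  refine Algebra.adjoin_le ?_
  rintro _ ⟨σ, rfl⟩
  exact ⟨Psi_mem_finDDHA σ, fun v => (expOp_conj_eq_iff _ v).mpr (Psi_mul_Phi σ _).symm⟩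

/-! ### The action on symmetric tensors -/

/-- Permutations fix η^{⊗r}. A place projection fixes it if its set of places is empty and kills it
otherwise. -/
lemma exists_apply_eta_eq_smul {φ : Module.End ℂ (TensorSpace V r)} (hφ : φ ∈ finDDHA V r) :
    ∃ c : ℂ, φ (PiTensorProduct.tprod ℂ fun _ => ((0, 1) : V × ℂ)) =
      c • PiTensorProduct.tprod ℂ fun _ => ((0, 1) : V × ℂ) := by
  let w : TensorSpace V r := PiTensorProduct.tprod ℂ fun _ => ((0, 1) : V × ℂ)
  let C : Subalgebra ℂ (Module.End ℂ (TensorSpace V r)) :=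
    { carrier := {φ | ∃ c : ℂ, φ w = c • w}
      mul_mem' := by
        rintro φ ψ ⟨c, hc⟩ ⟨d, hd⟩
        exact ⟨d * c, by rw [Module.End.mul_apply, hd, map_smul, hc, smul_smul]⟩
      add_mem' := by
        rintro φ ψ ⟨c, hc⟩ ⟨d, hd⟩
        exact ⟨c + d, by rw [LinearMap.add_apply, hc, hd, add_smul]⟩
      algebraMap_mem' := fun c => ⟨c, rfl⟩ }
  have h : finDDHA V r ≤ C := by
    refine finDDHA_le_of_Psi_placeProj (fun σ => ⟨1, ?_⟩) (fun s => ?_)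
    · rw [Psi_tprod, one_smul]
    · by_cases hs : ∃ i, i ∈ s
      · obtain ⟨i, hi⟩ := hs
        refine ⟨0, ?_⟩
        rw [placeProj, PiTensorProduct.map_tprod, zero_smul]
        refine MultilinearMap.map_coord_zero _ i ?_
        simp [hi, projV]
      · refine ⟨1, ?_⟩
        rw [placeProj, PiTensorProduct.map_tprod, one_smul]
        congr 1
        funext i
        rw [if_neg fun hi => hs ⟨i, hi⟩]
        simp [projEta]
  exact h hφ

/-- The symmetric tensors are spanned by the powers of the vectors outside `V`. -/
lemma invariants_le_span :
    (Psi V r).invariants ≤ Submodule.span ℂ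
      ((fun y : V × ℂ => PiTensorProduct.tprod ℂ fun _ : Fin r => y) '' {y | y.2 ≠ 0}) := by
  intro w hw
  have hU : ∀ x : V × ℂ, {t : ℂ | x + t • ((0, 1) : V × ℂ) ∉ {y : V × ℂ | y.2 ≠ 0}}.Finite :=
    fun x => (Set.finite_singleton (-x.2)).subset fun t ht => by
      refine eq_neg_of_add_eq_zero_right ?_
      simpa using ht
  have hsym : ∀ w : TensorSpace V r, (∑ σ : Equiv.Perm (Fin r), Psi V r σ) w ∈
      Submodule.span ℂ
        ((fun y : V × ℂ => PiTensorProduct.tprod ℂ fun _ : Fin r => y) '' {y | y.2 ≠ 0}) := by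
    intro w
    have hw : w ∈ Submodule.span ℂ
        (Set.range (PiTensorProduct.tprod ℂ (s := fun _ : Fin r => V × ℂ))) := by
      rw [PiTensorProduct.span_tprod_eq_top]; trivial
    refine (Submodule.span_le (p := (Submodule.span ℂ _).comap _)).mpr ?_ hw
    rintro _ ⟨v, rfl⟩
    rw [SetLike.mem_coe, Submodule.mem_comap, LinearMap.sum_apply]
    simp only [Psi_tprod]
    rw [← Equiv.sum_comp (Equiv.inv (Equiv.Perm (Fin r)))]
    exact multilinear_sum_perm_mem_span_diag (PiTensorProduct.tprod ℂ) _ _ hU v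
  have h := hsym w
  rw [LinearMap.sum_apply, Finset.sum_congr rfl fun σ _ => hw σ, Finset.sum_const,
    Finset.card_univ, Fintype.card_perm, ← Nat.cast_smul_eq_nsmul ℂ] at h
  exact (Submodule.smul_mem_iff _ (Nat.cast_ne_zero.mpr (Nat.factorial_ne_zero _))).mp h

lemma exists_parabolic_tprod_eq {y : V × ℂ} (hy : y.2 ≠ 0) : ∃ g ∈ parabolic V,
    Phi V r g (PiTensorProduct.tprod ℂ fun _ => ((0, 1) : V × ℂ)) =
      PiTensorProduct.tprod ℂ fun _ => y := by
  -- The torus scales η to y.2 η. The translation then adds y.2 times its vector, hence the factor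
  -- y.2⁻¹.
  refine ⟨enhancedHom V (EnhancedGL.exp (y.2⁻¹ • y.1)) * multHom V (Units.mk0 y.2 hy),
    mul_mem (enhancedHom_mem_parabolic _) (multHom_mem_parabolic _), ?_⟩
  change PiTensorProduct.map _ _ = _
  rw [PiTensorProduct.map_tprod]
  congr 1
  funext i
  ext <;> simp [enhancedHom, multHom, hy]

/-- The elements of `D(n, r)^V` act on the symmetric tensors by scalars. -/
lemma exists_apply_invariants_eq_smul {φ : Module.End ℂ (TensorSpace V r)}
    (hφ : φ ∈ finDDHAInv V r) : ∃ c : ℂ, ∀ w ∈ (Psi V r).invariants, φ w = c • w := by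
  obtain ⟨c, hc⟩ := exists_apply_eta_eq_smul hφ.1
  refine ⟨c, fun w hw => ?_⟩
  have h : (Psi V r).invariants ≤ LinearMap.eqLocus φ (c • LinearMap.id) := by
    refine invariants_le_span.trans (Submodule.span_le.mpr ?_)
    rintro _ ⟨y, hy, rfl⟩
    obtain ⟨g, hg, hgy⟩ := exists_parabolic_tprod_eq (r := r) hy
    change φ (PiTensorProduct.tprod ℂ fun _ => y) = c • PiTensorProduct.tprod ℂ fun _ => y
    rw [← hgy, ← Module.End.mul_apply, ← commute_of_mem_finDDHAInv hφ hg, Module.End.mul_apply, hc,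
      map_smul]
  exact h hw

lemma finDDHAInv_le_sup : Subalgebra.toSubmodule (finDDHAInv V r) ≤
    Subalgebra.toSubmodule (permAlgebra V r) ⊔ finDDHAAnn V r := by
  intro φ hφ
  have hφ' : φ ∈ finDDHAInv V r := hφ
  obtain ⟨c, hc⟩ := exists_apply_invariants_eq_smul hφ'
  have hann : φ + (-c) • 1 ∈ finDDHAAnn V r := by
    refine ⟨add_mem hφ'.1 ((finDDHA V r).smul_mem (one_mem _) _), fun w hw => ?_⟩
    rw [LinearMap.add_apply, hc w hw, LinearMap.smul_apply, Module.End.one_apply, ← add_smul,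
      add_neg_cancel, zero_smul]
  have hperm : c • 1 ∈ Subalgebra.toSubmodule (permAlgebra V r) :=
    (permAlgebra V r).smul_mem (one_mem _) c
  have e : c • 1 + (φ + (-c) • 1) = φ := by
    rw [add_left_comm, ← add_smul, add_neg_cancel, zero_smul, add_zero]
  rw [← e]
  exact Submodule.add_mem_sup hperm hann

end Parabolic

end EnhancedSchurWeyl

theorem theorem5p3 (V : Type*) [AddCommGroup V] [Module ℂ V] [FiniteDimensional ℂ V]
    (r : ℕ) (hr : 0 < r) :
    Subalgebra.centralizer ℂ (parabolicSchur V r : Set (Module.End ℂ (TensorSpace V r))) =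
        finDDHAInv V r ∧
      permAlgebra V r ≤ finDDHAInv V r ∧
      Subalgebra.toSubmodule (finDDHAInv V r) ≤
        Subalgebra.toSubmodule (permAlgebra V r) ⊔ finDDHAAnn V r :=
  ⟨centralizer_parabolicSchur_eq, permAlgebra_le_finDDHAInv, finDDHAInv_le_sup⟩
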